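/- Work on $\mathbb C^2\otimes\mathcal H$ with $\mathcal H$ finite-dimensional (a truncated bosonic mode) and let $\sigma^x,\sigma^y,\sigma^z$ be the Pauli matrices on the qubit. Let $\hat x,\hat p$ be Hermitian operators on $\mathcal H$, in particular, for a Fock cutoff $\Lambda\in\mathbb N$, the operators $\hat x=\tfrac12(a+a^\dagger)$ and $\hat p=-\tfrac i2(a-a^\dagger)$, where $a$ is the annihilation operator truncated to the span of the Fock states $|0\rangle,\dots,|\Lambda\rangle$. Put $$C=\max\bigl(\|\hat x^2+\hat p^2\|,\ \|\hat x\|^2,\ \|\hat p\|^2\bigr)$$ (operator norms), and for an operator $A$ on $\mathcal H$ let $\mathcal B_A(t)=\exp\Bigl(it\begin{bmatrix}0&A\\A^\dagger&0\end{bmatrix}\Bigr)$, so that $\mathcal B_A(t)=e^{itA\sigma^x}$ when $A$ is Hermitian. Suppose the conditional displacements $e^{it\hat x\sigma^i}$ and $e^{it\hat p\sigma^i}$ ($t\in\mathbb R$, $i\in\{x,y,z\}$) can be implemented without error. Then for every integer $p\ge1$ there is a constant $K$ depending only on $p$, and for every $k\in\{x,y,z\}$ there are 1. a fixed sequence $(i_1,c_1),\dots,(i_m,c_m)$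 of Pauli axes and real numbers, with $m\le 8\cdot 6^{p-1}$, giving for $Q\in\{\hat x,\hat p\}$ the synthesized exponential $\widetilde E_Q(s)=\prod_{l=1}^m e^{ic_l\sqrt{s}\,Q\sigma^{i_l}}$ for $s\ge0$, and $\widetilde E_Q(s)=\widetilde E_Q(-s)^{-1}$ for $s<0$; 2. a fixed sequence $(Q_1,r_1),\dots,(Q_N,r_N)$ with $Q_j\in\{\hat x,\hat p\}$, $r_j\in\mathbb R$ and $$N\le 4\cdot5^{\frac p2-\frac14},$$ both independent of the mode space, of $\hat x,\hat p$ and of $t$, such that $\|\widetilde E_Q(s)-e^{isQ^2\sigma^k}\|\le K(\|Q\|^2|s|)^{p+1/2}$ for every Hermitian $Q$ and all $s\in\mathbb R$, and the product $\widetilde{\mathcal B}(t)=\prod_{j=1}^N\widetilde E_{Q_j}(r_jt)$ of $N$ synthesized exponentials satisfies $$\bigl\|\widetilde{\mathcal B}(t)-e^{it(\hat x^2+\hat p^2)\sigma^k}\bigr\|\le K\,(Ct)^{p+\frac12}\qquad\text{for all }t\ge0.$$ In particular ($k=x$) the block encoding is approximated: $\|\widetilde{\mathcal B}(t)-\mathcal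 B_{\hat x^2+\hat p^2}(t)\|\in\mathcal O((Ct)^{p+1/2})$. Consequently, for the Fock cutoff $\Lambda$ and $\hat n=a^\dagger a$, following $\widetilde{\mathcal B}(t)$ by the qubit rotation $e^{-it\sigma^k/2}$ approximates the conditional rotation $e^{it\hat n\sigma^k}$ on states supported strictly below the cutoff: $$\bigl\|\bigl(e^{-it\sigma^k/2}\,\widetilde{\mathcal B}(t)-e^{it\hat n\sigma^k}\bigr)(1\otimes P_{<\Lambda})\bigr\|\le K\,(Ct)^{p+\frac12}\qquad\text{for all }t\ge0,$$ where $P_{<\Lambda}$ is the projector onto the span of the $|n\rangle$ with $n<\Lambda$. -/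

import Mathlib

open scoped Matrix.Norms.L2Operator

namespace QubitMode

/-- The three Pauli axes. -/
inductive PauliAxis
  | x
  | y
  | z

/-- The Pauli matrices. -/
def pauli : PauliAxis → Matrix (Fin 2) (Fin 2) ℂ
  | .x => !![0, 1; 1, 0]
  | .y => !![0, -Complex.I; Complex.I, 0]
  | .z => !![1, 0; 0, -1]

/-- The operator `S ⊗ A` (qubit operator `S`, mode operator `A`) on qubit ⊗ mode, written as a
`2 × 2` block matrix whose blocks are mode operators. -/
def qubitTensor {n : Type} (S : Matrix (Fin 2) (Fin 2) ℂ) (A : Matrix n n ℂ) :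
    Matrix (n ⊕ n) (n ⊕ n) ℂ :=
  Matrix.fromBlocks (S 0 0 • A) (S 0 1 • A) (S 1 0 • A) (S 1 1 • A)

/-- The hybrid exponential `exp(i t A σ^k)`. -/
noncomputable def hybridExp {n : Type} [Fintype n] [DecidableEq n]
    (k : PauliAxis) (A : Matrix n n ℂ) (t : ℝ) : Matrix (n ⊕ n) (n ⊕ n) ℂ :=
  NormedSpace.exp ((Complex.I * (t : ℂ)) • qubitTensor (pauli k) A)

/-- The block encoding `exp(i t [[0, A], [A†, 0]])`. -/
noncomputable def blockEncoding {n : Type} [Fintype n] [DecidableEq n]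
    (A : Matrix n n ℂ) (t : ℝ) : Matrix (n ⊕ n) (n ⊕ n) ℂ :=
  NormedSpace.exp ((Complex.I * (t : ℂ)) • Matrix.fromBlocks 0 A A.conjTranspose 0)

/-- The annihilation operator with Fock cutoff `L`, on the span of the Fock states
`|0⟩, …, |L⟩`: `a |n⟩ = √n |n - 1⟩`. -/
noncomputable def annihilation (L : ℕ) : Matrix (Fin (L + 1)) (Fin (L + 1)) ℂ :=
  Matrix.of fun m n => if (m : ℕ) + 1 = (n : ℕ) then ((Real.sqrt (n : ℕ) : ℝ) : ℂ) else 0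

/-- The position operator `(a + a†) / 2` with Fock cutoff `L`. -/
noncomputable def positionOp (L : ℕ) : Matrix (Fin (L + 1)) (Fin (L + 1)) ℂ :=
  (1 / 2 : ℂ) • (annihilation L + (annihilation L).conjTranspose)

/-- The momentum operator `-(i / 2) (a - a†)` with Fock cutoff `L`. -/
noncomputable def momentumOp (L : ℕ) : Matrix (Fin (L + 1)) (Fin (L + 1)) ℂ :=
  (-(Complex.I / 2)) • (annihilation L - (annihilation L).conjTranspose)

/-- The number operator `a† a` with Fock cutoff `L`. -/
noncomputable def numberOp (L : ℕ) : Matrix (Fin (L + 1)) (Fin (L + 1)) ℂ :=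
  (annihilation L).conjTranspose * annihilation L

/-- The projector onto the Fock states `|n⟩` with `n < L` (strictly below the cutoff). -/
def belowCutoff (L : ℕ) : Matrix (Fin (L + 1)) (Fin (L + 1)) ℂ :=
  Matrix.diagonal fun n => if (n : ℕ) < L then 1 else 0

/-- The two quadratures of the mode. -/
inductive Quadrature
  | position
  | momentum

/-- The operator of a quadrature, for position operator `X` and momentum operator `P`. -/
def Quadrature.op {n : Type} (X P : Matrix n n ℂ) : Quadrature → Matrix n n ℂ
  | .position => X
  | .momentum => P

/-- The product, in the order of the list `W`, of the exact conditional displacements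
`exp(i c τ Q σ^j)`, one for each entry `(j, c)` of `W`. -/
noncomputable def displacementProd {n : Type} [Fintype n] [DecidableEq n]
    (W : List (PauliAxis × ℝ)) (Q : Matrix n n ℂ) (τ : ℝ) : Matrix (n ⊕ n) (n ⊕ n) ℂ :=
  (W.map fun g => hybridExp g.1 Q (g.2 * τ)).prod

/-- The sequence of conditional displacements that undoes `W`: reversed order, opposite times. -/
def undo (W : List (PauliAxis × ℝ)) : List (PauliAxis × ℝ) :=
  (W.map fun g => (g.1, -g.2)).reverse

/-- The exponential for time `s` synthesized from the conditional displacements of `Q` by the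
sequence `W`, run with step `√s`; for a negative time the inverse sequence is run with step
`√(-s)`. It uses `W.length` conditional displacements. -/
noncomputable def synthExp {n : Type} [Fintype n] [DecidableEq n]
    (W : List (PauliAxis × ℝ)) (Q : Matrix n n ℂ) (s : ℝ) : Matrix (n ⊕ n) (n ⊕ n) ℂ :=
  if 0 ≤ s then displacementProd W Q (Real.sqrt s)
  else displacementProd (undo W) Q (Real.sqrt (-s))

/-- The product formula `T` for time `t`: the product, in the order of the list `T`, of the
synthesized exponentials of the quadrature `q` for time `c t`, one for each entry `(q, c)`
of `T`. -/
noncomputable def productFormula {n : Type} [Fintype n] [DecidableEq n]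
    (T : List (Quadrature × ℝ)) (W : List (PauliAxis × ℝ)) (X P : Matrix n n ℂ) (t : ℝ) :
    Matrix (n ⊕ n) (n ⊕ n) ℂ :=
  (T.map fun g => synthExp W (g.1.op X P) (g.2 * t)).prod

/-- `C = max(‖X² + P²‖, ‖X‖², ‖P‖²)`, in the operator norm. -/
noncomputable def scaleConst {n : Type} [Fintype n] [DecidableEq n] (X P : Matrix n n ℂ) : ℝ :=
  max ‖X ^ 2 + P ^ 2‖ (max (‖X‖ ^ 2) (‖P‖ ^ 2))

end QubitMode

open QubitMode

namespace QubitMode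

/-! Two product formulas are nested. With `A_l = i τ Q σ^l` and `τ = √s`, a suitable pair of Pauli
axes satisfies `[A_i, A_j] = 2 i s Q² σ^k`, so words in conditional displacements approximate `exp(i
s Q² σ^k)` through group commutators. A Suzuki formula then splits `exp(i t (X² + P²) σ^k)` into
exponentials of `X²` and `P²`.

Both kinds of words are built over formal power series in `τ`, with coefficients in an arbitrary
ℂ-algebra. If a word agrees with `exp(s τ^r H)` below degree `m`, its error `e` in degree `m` adds
under concatenation, changes sign under inversion, and is multiplied by `a^m` when the word is
rescaled by `a`, while `s` is multiplied by `a^r` (`WordError`). Raising the order thus amounts to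
solving two scalar equations: the times add up to 1, the errors to 0 (`exists_commutator_step`,
`exists_suzuki_step`). A word found this way serves every algebra, hence every mode space, every
`X`, `P` and every `t`.

To return to matrices, the parameter is absorbed into the generators. If these have norm at most `κ
u` with `u ≤ 1`, the `n`-th coefficient is at most `u^n` times that of a fixed convergent series, so
agreement below degree `m` gives an error `O(u^m)` (`Reproduces.norm_sub_le`). For `u > 1` the bound
is trivial, all operators involved being contractions. Contractivity also lets the synthesis errors
of the factors simply add (`norm_productFormula_sub_exactFormula_le`).

For the truncated mode, `x̂² + p̂²` equals `n̂ + 1/2` strictly below the cutoff, and the qubit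
rotation removes the `1/2`. -/

/-! ### Formal exponentials and words of exponentials -/

section LeadingTerm

open PowerSeries Finset.HasAntidiagonal

variable {𝒜 : Type} [Ring 𝒜]

/-- The series `D` is `e τ^m` up to terms of order greater than `m`. -/
def HasLeadingTerm (m : ℕ) (D : PowerSeries 𝒜) (e : 𝒜) : Prop :=
  (∀ n < m, coeff n D = 0) ∧ coeff m D = e

/-- A factor with constant term 1 leaves the lowest coefficient unchanged. This is what makes
leading errors additive in products. -/
lemma HasLeadingTerm.mul_right {m : ℕ} {D : PowerSeries 𝒜} {e : 𝒜} (h : HasLeadingTerm m D e)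
    {U : PowerSeries 𝒜} (hU : coeff 0 U = 1) : HasLeadingTerm m (D * U) e := by
  refine ⟨fun n hn => ?_, ?_⟩
  · rw [coeff_mul]
    refine Finset.sum_eq_zero fun a ha => ?_
    rw [h.1 a.1 ((antidiagonal.fst_le ha).trans_lt hn), zero_mul]
  · rw [coeff_mul, Finset.sum_eq_single (m, 0), hU, h.2, mul_one]
    · intro a ha hne
      rw [h.1, zero_mul]
      refine lt_of_le_of_ne (antidiagonal.fst_le ha) fun h' => hne ?_
      have := mem_antidiagonal.mp ha
      exact Prod.ext h' (by simp only; omega)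
    · simp

lemma HasLeadingTerm.mul_left {m : ℕ} {D : PowerSeries 𝒜} {e : 𝒜} (h : HasLeadingTerm m D e)
    {U : PowerSeries 𝒜} (hU : coeff 0 U = 1) : HasLeadingTerm m (U * D) e := by
  refine ⟨fun n hn => ?_, ?_⟩
  · rw [coeff_mul]
    refine Finset.sum_eq_zero fun a ha => ?_
    rw [h.1 a.2 ((antidiagonal.snd_le ha).trans_lt hn), mul_zero]
  · rw [coeff_mul, Finset.sum_eq_single (0, m), hU, h.2, one_mul]
    · intro a ha hne
      rw [h.1, mul_zero]
      refine lt_of_le_of_ne (antidiagonal.snd_le ha) fun h' => hne ?_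
      have := mem_antidiagonal.mp ha
      exact Prod.ext (by simp only; omega) h'
    · simp

lemma HasLeadingTerm.add {m : ℕ} {D D' : PowerSeries 𝒜} {e e' : 𝒜} (h : HasLeadingTerm m D e)
    (h' : HasLeadingTerm m D' e') : HasLeadingTerm m (D + D') (e + e') :=
  ⟨fun n hn => by rw [map_add, h.1 n hn, h'.1 n hn, add_zero], by rw [map_add, h.2, h'.2]⟩

lemma HasLeadingTerm.neg {m : ℕ} {D : PowerSeries 𝒜} {e : 𝒜} (h : HasLeadingTerm m D e) :
    HasLeadingTerm m (-D) (-e) :=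
  ⟨fun n hn => by rw [map_neg, h.1 n hn, neg_zero], by rw [map_neg, h.2]⟩

end LeadingTerm

section Formal

open PowerSeries Finset.HasAntidiagonal

variable {𝒜 : Type} [Ring 𝒜] [Algebra ℂ 𝒜] {ι : Type}

/-- The formal power series `exp(s τ^r H)` in the variable `τ`. -/
noncomputable def formalExp (r : ℕ) (s : ℝ) (H : 𝒜) : PowerSeries 𝒜 :=
  PowerSeries.mk fun n => if r ∣ n then
    (((s : ℂ) ^ (n / r)) / ((n / r).factorial : ℂ)) • H ^ (n / r) else 0

lemma coeff_formalExp (r : ℕ) (s : ℝ) (H : 𝒜) (n : ℕ) :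
    coeff n (formalExp r s H) = if r ∣ n then
      (((s : ℂ) ^ (n / r)) / ((n / r).factorial : ℂ)) • H ^ (n / r) else 0 :=
  coeff_mk _ _

lemma coeff_zero_formalExp (r : ℕ) (s : ℝ) (H : 𝒜) : coeff 0 (formalExp r s H) = 1 := by
  simp [coeff_formalExp]

lemma formalExp_zero (r : ℕ) (hr : 0 < r) (H : 𝒜) : formalExp r 0 H = 1 := by
  ext n
  rw [coeff_formalExp, coeff_one]
  split_ifs with h1 h2 h2
  · simp [h2]
  · have : n / r ≠ 0 := (Nat.div_pos (Nat.le_of_dvd (Nat.pos_of_ne_zero h2) h1) hr).ne'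
    simp [this]
  · simp [h2] at h1
  · rfl

lemma sum_antidiagonal_pow_div_factorial (x y : ℂ) (n : ℕ) :
    ∑ m ∈ antidiagonal n, x ^ m.1 / (m.1.factorial : ℂ) * (y ^ m.2 / (m.2.factorial : ℂ))
      = (x + y) ^ n / (n.factorial : ℂ) := by
  rw [(Commute.all x y).add_pow', Finset.sum_div]
  refine Finset.sum_congr rfl fun m hm => ?_
  rw [← mem_antidiagonal.mp hm, nsmul_eq_mul]
  have h : (((m.1 + m.2).choose m.1 : ℕ) : ℂ) * m.1.factorial * m.2.factorial
      = (m.1 + m.2).factorial := by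
    rw [Nat.choose_symm_add]
    exact_mod_cast Nat.add_choose_mul_factorial_mul_factorial m.1 m.2
  have h1 : ((m.1 + m.2).factorial : ℂ) ≠ 0 := by exact_mod_cast Nat.factorial_ne_zero _
  have h2 : (m.1.factorial : ℂ) ≠ 0 := by exact_mod_cast Nat.factorial_ne_zero _
  have h3 : (m.2.factorial : ℂ) ≠ 0 := by exact_mod_cast Nat.factorial_ne_zero _
  field_simp
  rw [← h]
  ring

lemma formalExp_mul (r : ℕ) (hr : 0 < r) (s t : ℝ) (H : 𝒜) :
    formalExp r s H * formalExp r t H = formalExp r (s + t) H := by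
  ext n
  rw [coeff_mul, coeff_formalExp]
  split_ifs with h
  · obtain ⟨k, rfl⟩ := h
    rw [Nat.mul_div_cancel_left _ hr, Complex.ofReal_add, ← sum_antidiagonal_pow_div_factorial,
      Finset.sum_smul]
    symm
    -- Only the pairs with both degrees divisible by `r` contribute to the Cauchy product; on these
    -- it is the binomial theorem.
    refine Finset.sum_of_injOn (fun m => (r * m.1, r * m.2)) ?_ ?_ ?_ ?_
    · intro a _ b _ hab
      simp only [Prod.mk.injEq] at hab
      exact Prod.ext (Nat.eq_of_mul_eq_mul_left hr hab.1) (Nat.eq_of_mul_eq_mul_left hr hab.2)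
    · intro a ha
      simp only [Finset.mem_coe, mem_antidiagonal] at ha ⊢
      rw [← mul_add, ha]
    · intro a ha hna
      rw [coeff_formalExp, coeff_formalExp]
      by_cases h1 : r ∣ a.1
      · by_cases h2 : r ∣ a.2
        · refine absurd ?_ hna
          obtain ⟨b, hb⟩ := h1
          obtain ⟨c, hc⟩ := h2
          refine ⟨(b, c), ?_, Prod.ext hb.symm hc.symm⟩
          simp only [Finset.mem_coe, mem_antidiagonal] at ha ⊢
          exact Nat.eq_of_mul_eq_mul_left hr (by rw [mul_add, ← hb, ← hc, ha])
        · simp [h2]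
      · simp [h1]
    · intro a ha
      rw [coeff_formalExp, coeff_formalExp, if_pos (dvd_mul_right _ _), if_pos (dvd_mul_right _ _)]
      simp only [Nat.mul_div_cancel_left _ hr]
      rw [smul_mul_smul_comm, ← pow_add, mem_antidiagonal.mp ha]
  · refine Finset.sum_eq_zero fun a ha => ?_
    rw [coeff_formalExp, coeff_formalExp]
    by_cases h1 : r ∣ a.1
    · have h2 : ¬ r ∣ a.2 := fun h2 => h (mem_antidiagonal.mp ha ▸ dvd_add h1 h2)
      simp [h2]
    · simp [h1]

lemma coeff_formalExp_pow_mul (r : ℕ) (a s : ℝ) (H : 𝒜) (n : ℕ) :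
    coeff n (formalExp r (a ^ r * s) H) = ((a : ℂ) ^ n) • coeff n (formalExp r s H) := by
  rw [coeff_formalExp, coeff_formalExp]
  split_ifs with h
  · rw [smul_smul]
    congr 1
    obtain ⟨k, rfl⟩ := h
    rcases Nat.eq_zero_or_pos r with rfl | hr
    · simp
    rw [Nat.mul_div_cancel_left _ hr]
    push_cast
    rw [mul_pow, ← pow_mul]
    ring
  · simp

/-- The product of the formal exponentials `exp(c τ A_i)`, one for each entry `(i, c)`. -/
noncomputable def wordSeries (A : ι → 𝒜) (W : List (ι × ℝ)) : PowerSeries 𝒜 :=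
  (W.map fun g => formalExp 1 g.2 (A g.1)).prod

/-- Multiply all the times of a word by `a`. -/
def rescaleWord (a : ℝ) (W : List (ι × ℝ)) : List (ι × ℝ) := W.map fun g => (g.1, a * g.2)

/-- The word of the inverse product. -/
def inverseWord (W : List (ι × ℝ)) : List (ι × ℝ) := (W.map fun g => (g.1, -g.2)).reverse

@[simp] lemma length_rescaleWord (a : ℝ) (W : List (ι × ℝ)) :
    (rescaleWord a W).length = W.length := by simp [rescaleWord]

@[simp] lemma length_inverseWord (W : List (ι × ℝ)) : (inverseWord W).length = W.length := by
  simp [inverseWord]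

lemma wordSeries_append (A : ι → 𝒜) (W V : List (ι × ℝ)) :
    wordSeries A (W ++ V) = wordSeries A W * wordSeries A V := by
  simp [wordSeries]

lemma coeff_wordSeries_rescaleWord (A : ι → 𝒜) (a : ℝ) (W : List (ι × ℝ)) (n : ℕ) :
    coeff n (wordSeries A (rescaleWord a W)) = ((a : ℂ) ^ n) • coeff n (wordSeries A W) := by
  induction W generalizing n with
  | nil =>
    rcases Nat.eq_zero_or_pos n with rfl | hn
    · simp [wordSeries, rescaleWord]
    · simp [wordSeries, rescaleWord, coeff_one, hn.ne']
  | cons g W ih =>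
    change coeff n (formalExp 1 (a * g.2) (A g.1) * wordSeries A (rescaleWord a W))
      = ((a : ℂ) ^ n) • coeff n (formalExp 1 g.2 (A g.1) * wordSeries A W)
    rw [coeff_mul, coeff_mul, Finset.smul_sum]
    refine Finset.sum_congr rfl fun m hm => ?_
    rw [ih, ← mem_antidiagonal.mp hm, pow_add, ← smul_mul_smul_comm]
    have := coeff_formalExp_pow_mul 1 a g.2 (A g.1) m.1
    rw [pow_one] at this
    rw [this]

lemma wordSeries_mul_inverseWord (A : ι → 𝒜) (W : List (ι × ℝ)) :
    wordSeries A W * wordSeries A (inverseWord W) = 1 := by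
  induction W with
  | nil => simp [wordSeries, inverseWord]
  | cons g W ih =>
    have h : inverseWord (g :: W) = inverseWord W ++ [(g.1, -g.2)] := by simp [inverseWord]
    rw [h, wordSeries_append]
    change formalExp 1 g.2 (A g.1) * wordSeries A W *
      (wordSeries A (inverseWord W) * wordSeries A [(g.1, -g.2)]) = 1
    rw [mul_assoc, ← mul_assoc (wordSeries A W), ih, one_mul]
    simp [wordSeries, formalExp_mul, formalExp_zero]

lemma inverseWord_inverseWord (W : List (ι × ℝ)) : inverseWord (inverseWord W) = W := by
  simp [inverseWord, Function.comp_def]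

lemma wordSeries_inverseWord_mul (A : ι → 𝒜) (W : List (ι × ℝ)) :
    wordSeries A (inverseWord W) * wordSeries A W = 1 := by
  have := wordSeries_mul_inverseWord A (inverseWord W)
  rwa [inverseWord_inverseWord] at this

/-- The word `W` reproduces `exp(s τ^r H)` with error `e τ^m` to leading order. -/
def WordError (A : ι → 𝒜) (r : ℕ) (H : 𝒜) (m : ℕ) (W : List (ι × ℝ)) (s : ℝ) (e : 𝒜) : Prop :=
  HasLeadingTerm m (wordSeries A W - formalExp r s H) e

lemma coeff_zero_wordSeries (A : ι → 𝒜) (W : List (ι × ℝ)) : coeff 0 (wordSeries A W) = 1 := by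
  induction W with
  | nil => simp [wordSeries]
  | cons g W ih =>
    change coeff 0 (formalExp 1 g.2 (A g.1) * wordSeries A W) = 1
    rw [coeff_mul]
    simp only [Finset.Nat.antidiagonal_zero, Finset.sum_singleton]
    rw [ih, coeff_zero_formalExp, mul_one]

variable {A : ι → 𝒜} {r : ℕ} {H : 𝒜} {m : ℕ}

/-- Telescoping: `W V - E F = (W - E) V + E (V - F)`, where `V` and `E` have constant term 1. -/
lemma WordError.append (hr : 0 < r) {W V : List (ι × ℝ)} {s t : ℝ} {e f : 𝒜}
    (hW : WordError A r H m W s e) (hV : WordError A r H m V t f) :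
    WordError A r H m (W ++ V) (s + t) (e + f) := by
  have h : wordSeries A (W ++ V) - formalExp r (s + t) H
      = (wordSeries A W - formalExp r s H) * wordSeries A V
        + formalExp r s H * (wordSeries A V - formalExp r t H) := by
    rw [wordSeries_append, ← formalExp_mul r hr]
    noncomm_ring
  rw [WordError, h]
  exact (hW.mul_right (coeff_zero_wordSeries _ _)).add (hV.mul_left (coeff_zero_formalExp _ _ _))

/-- From `W⁻¹ - E⁻¹ = -W⁻¹ (W - E) E⁻¹`, where both inverses have constant term 1. -/
lemma WordError.inverseWord (hr : 0 < r) {W : List (ι × ℝ)} {s : ℝ} {e : 𝒜}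
    (hW : WordError A r H m W s e) : WordError A r H m (inverseWord W) (-s) (-e) := by
  have h : wordSeries A (QubitMode.inverseWord W) - formalExp r (-s) H
      = -(wordSeries A (QubitMode.inverseWord W) * (wordSeries A W - formalExp r s H)
        * formalExp r (-s) H) := by
    rw [mul_sub, wordSeries_inverseWord_mul, sub_mul, mul_assoc, formalExp_mul r hr,
      add_neg_cancel, formalExp_zero r hr]
    noncomm_ring
  rw [WordError, h]
  exact ((hW.mul_left (coeff_zero_wordSeries _ _)).mul_right (coeff_zero_formalExp _ _ _)).neg

lemma WordError.rescaleWord {W : List (ι × ℝ)} {s : ℝ} {e : 𝒜} (hW : WordError A r H m W s e)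
    (a : ℝ) : WordError A r H m (rescaleWord a W) (a ^ r * s) (((a : ℂ) ^ m) • e) := by
  have h (n : ℕ) : coeff n (wordSeries A (QubitMode.rescaleWord a W) - formalExp r (a ^ r * s) H)
      = ((a : ℂ) ^ n) • coeff n (wordSeries A W - formalExp r s H) := by
    rw [map_sub, map_sub, coeff_wordSeries_rescaleWord, coeff_formalExp_pow_mul, smul_sub]
  exact ⟨fun n hn => by rw [h, hW.1 n hn, smul_zero], by rw [h, hW.2]⟩

/-- The word `W` reproduces `exp(τ^r H)` up to terms of order at least `m`. -/
def Reproduces (A : ι → 𝒜) (r : ℕ) (H : 𝒜) (m : ℕ) (W : List (ι × ℝ)) : Prop :=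
  ∀ n < m, coeff n (wordSeries A W) = coeff n (formalExp r 1 H)

lemma Reproduces.wordError {W : List (ι × ℝ)} (h : Reproduces A r H m W) :
    ∃ e, WordError A r H m W 1 e :=
  ⟨_, fun n hn => by rw [map_sub, h n hn, sub_self], rfl⟩

lemma WordError.reproduces {W : List (ι × ℝ)} {e : 𝒜} (h : WordError A r H m W 1 e) (he : e = 0) :
    Reproduces A r H (m + 1) W := by
  intro n hn
  rw [← sub_eq_zero, ← map_sub]
  rcases Nat.lt_succ_iff_lt_or_eq.mp hn with h' | rfl
  · exact h.1 n h'
  · rw [h.2, he]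

end Formal

/-! ### Raising the order of a word -/

section Recursion

open PowerSeries Finset.HasAntidiagonal

lemma exists_nonneg_pow_eq {m : ℕ} (hm : m ≠ 0) {x : ℝ} (hx : 0 ≤ x) :
    ∃ β : ℝ, 0 ≤ β ∧ β ^ m = x :=
  ⟨x ^ (m⁻¹ : ℝ), by positivity, Real.rpow_inv_natCast_pow hx hm⟩

/-- Put `b = β a` with `β^(2q+2) = 2`: the second equation holds for every `a`, and the first reads
`a² (2 - β²) = 1`, solvable since `β² = 2^(1/(q+1)) < 2`. -/
lemma exists_commutator_times (q : ℕ) (hq : 1 ≤ q) :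
    ∃ a b : ℝ, a ^ 2 + a ^ 2 - b ^ 2 = 1 ∧
      a ^ (2 * q + 2) + a ^ (2 * q + 2) - b ^ (2 * q + 2) = 0 := by
  obtain ⟨β, h0, hβ⟩ := exists_nonneg_pow_eq (m := 2 * q + 2) (by omega) (zero_le_two (α := ℝ))
  have hlt : β ^ 2 < 2 := by
    by_contra! h
    have h1 : (2 : ℝ) ^ (q + 1) ≤ (β ^ 2) ^ (q + 1) := by gcongr
    have h2 : (2 : ℝ) ^ 2 ≤ 2 ^ (q + 1) := pow_le_pow_right₀ (by norm_num) (by omega)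
    rw [← pow_mul, mul_add, mul_one, hβ] at h1
    linarith
  have hs : (√(2 - β ^ 2)) ^ 2 = 2 - β ^ 2 := Real.sq_sqrt (by linarith)
  have hne : (2 - β ^ 2) ≠ 0 := by linarith
  refine ⟨1 / √(2 - β ^ 2), β * (1 / √(2 - β ^ 2)), ?_, ?_⟩
  · rw [mul_pow, div_pow, hs]
    field_simp
    ring
  · rw [mul_pow, hβ]
    ring

/-- Put `b = -β a` with `β^m = 4`. As `m` is odd, the second equation holds for every `a`; the first
is `a (4 - β) = 1`, and `β ≠ 4` because `4^m ≥ 16`. -/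
lemma exists_suzuki_times (m : ℕ) (hm : 2 ≤ m) (hodd : Odd m) :
    ∃ a b : ℝ, a + a + b + a + a = 1 ∧ a ^ m + a ^ m + b ^ m + a ^ m + a ^ m = 0 := by
  obtain ⟨β, h0, hβ⟩ := exists_nonneg_pow_eq (m := m) (by omega) (zero_le_four (α := ℝ))
  have hne : 4 - β ≠ 0 := by
    intro h
    have h4 : β = 4 := by linarith
    have h2 : (4 : ℝ) ^ 2 ≤ 4 ^ m := pow_le_pow_right₀ (by norm_num) hm
    rw [h4] at hβ
    linarith
  refine ⟨1 / (4 - β), -(β * (1 / (4 - β))), ?_, ?_⟩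
  · field_simp
    ring
  · rw [hodd.neg_pow, mul_pow, hβ]
    ring

variable {ι : Type}

/-- Two orders are gained in two moves. Running `W` at scales `c` and `-c` cancels the error of odd
degree `2q+1`, while both halves contribute time `c² = 1/2`. Two copies of the result at scale `a`
and one inverse copy at scale `b` then cancel degree `2q+2`. The length grows by `2 · 3 = 6`. -/
lemma exists_commutator_step (q : ℕ) (hq : 1 ≤ q) (W : List (ι × ℝ)) :
    ∃ V : List (ι × ℝ), V.length = 6 * W.length ∧
      ∀ {𝒜 : Type} [Ring 𝒜] [Algebra ℂ 𝒜] (A : ι → 𝒜) (H : 𝒜),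
        Reproduces A 2 H (2 * q + 1) W → Reproduces A 2 H (2 * q + 3) V := by
  obtain ⟨a, b, h1, h2⟩ := exists_commutator_times q hq
  set c : ℝ := √(1 / 2) with hc
  have hc2 : c ^ 2 = 1 / 2 := Real.sq_sqrt (by norm_num)
  set U := rescaleWord c W ++ rescaleWord (-c) W with hU
  refine ⟨rescaleWord a U ++ rescaleWord a U ++ inverseWord (rescaleWord b U), ?_, ?_⟩
  · simp [hU]
    ring
  intro 𝒜 _ _ A H hW
  obtain ⟨e, he⟩ := hW.wordError
  have hr : 0 < 2 := two_pos
  have hU' : WordError A 2 H (2 * q + 1) U 1 0 := by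
    have h := (he.rescaleWord c).append hr (he.rescaleWord (-c))
    convert h using 1
    · rw [neg_sq, hc2]
      norm_num
    · have : Odd (2 * q + 1) := odd_two_mul_add_one q
      rw [Complex.ofReal_neg, this.neg_pow, neg_smul, add_neg_cancel]
  obtain ⟨f, hf⟩ := (hU'.reproduces rfl).wordError
  have h := ((hf.rescaleWord a).append hr (hf.rescaleWord a)).append hr
    ((hf.rescaleWord b).inverseWord hr)
  have h2' : (a : ℂ) ^ (2 * q + 2) + a ^ (2 * q + 2) - b ^ (2 * q + 2) = 0 := by
    exact_mod_cast h2
  have hs : a ^ 2 * 1 + a ^ 2 * 1 + -(b ^ 2 * 1) = 1 := by linarith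
  rw [hs] at h
  refine h.reproduces ?_
  rw [← add_smul, ← sub_eq_add_neg, ← sub_smul, h2', zero_smul]

lemma inverseWord_of_reverse_eq {W : List (ι × ℝ)} (h : W.reverse = W) :
    inverseWord W = rescaleWord (-1) W := by
  rw [inverseWord, ← List.map_reverse, h]
  simp [rescaleWord]

/-- For a palindrome, inversion is rescaling by `-1`. Inversion turns the leading error `e` into
`-e`, rescaling into `(-1)^m e = e`, so `e = 0`: errors of even degree come for free. -/
lemma Reproduces.succ_of_reverse_eq {𝒜 : Type} [Ring 𝒜] [Algebra ℂ 𝒜] {A : ι → 𝒜} {H : 𝒜} {m : ℕ}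
    {W : List (ι × ℝ)} (hW : Reproduces A 1 H m W) (hm : Even m) (h : W.reverse = W) :
    Reproduces A 1 H (m + 1) W := by
  obtain ⟨e, he⟩ := hW.wordError
  refine he.reproduces ?_
  have h1 := he.inverseWord one_pos
  have h2 := he.rescaleWord (-1)
  rw [inverseWord_of_reverse_eq h] at h1
  have h3 : (-1 : ℝ) ^ 1 * 1 = -1 := by norm_num
  have h4 : ((-1 : ℝ) : ℂ) ^ m = 1 := by
    rw [Complex.ofReal_neg, hm.neg_pow, Complex.ofReal_one, one_pow]
  rw [h3, h4, one_smul] at h2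
  have h5 : e = -e := h2.2.symm.trans h1.2
  have h6 : e = (1 / 2 : ℂ) • (e - -e) := by module
  rw [h6, ← h5, sub_self, smul_zero]

lemma reverse_rescaleWord (a : ℝ) (W : List (ι × ℝ)) :
    (rescaleWord a W).reverse = rescaleWord a W.reverse := by
  simp [rescaleWord]

/-- Five rescaled copies cancel degree `2q+1`; they form a palindrome again, which disposes of
degree `2q+2`. -/
lemma exists_suzuki_step (q : ℕ) (hq : 1 ≤ q) (W : List (ι × ℝ)) (hrev : W.reverse = W) :
    ∃ V : List (ι × ℝ), V.length = 5 * W.length ∧ V.reverse = V ∧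
      ∀ {𝒜 : Type} [Ring 𝒜] [Algebra ℂ 𝒜] (A : ι → 𝒜) (H : 𝒜),
        Reproduces A 1 H (2 * q + 1) W → Reproduces A 1 H (2 * q + 3) V := by
  have hodd : Odd (2 * q + 1) := odd_two_mul_add_one q
  obtain ⟨a, b, h1, h2⟩ := exists_suzuki_times (2 * q + 1) (by omega) hodd
  set V := rescaleWord a W ++ rescaleWord a W ++ rescaleWord b W ++ rescaleWord a W
    ++ rescaleWord a W with hV
  have hVrev : V.reverse = V := by simp [hV, reverse_rescaleWord, hrev]
  refine ⟨V, by simp [hV]; ring, hVrev, ?_⟩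
  intro 𝒜 _ _ A H hW
  obtain ⟨e, he⟩ := hW.wordError
  have hr : 0 < 1 := one_pos
  have ha := he.rescaleWord a
  have h := (((ha.append hr ha).append hr (he.rescaleWord b)).append hr ha).append hr ha
  have h2' : (a : ℂ) ^ (2 * q + 1) + a ^ (2 * q + 1) + b ^ (2 * q + 1) + a ^ (2 * q + 1)
      + a ^ (2 * q + 1) = 0 := by exact_mod_cast h2
  have hs : a ^ 1 * 1 + a ^ 1 * 1 + b ^ 1 * 1 + a ^ 1 * 1 + a ^ 1 * 1 = 1 := by linarith
  rw [hs, ← add_smul, ← add_smul, ← add_smul, ← add_smul, h2', zero_smul] at h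
  exact (h.reproduces rfl).succ_of_reverse_eq ⟨q + 1, by ring⟩ hVrev

/-- The group commutator, with generators `i` and `j`. -/
noncomputable def commutatorWord (i j : ι) : List (ι × ℝ) :=
  [(i, √(1 / 2)), (j, √(1 / 2)), (i, -√(1 / 2)), (j, -√(1 / 2))]

/-- The group commutator with step `c` is `1 + c² τ² [A_i, A_j] + O(τ³)`, and `c² = 1/2` compensates
the factor 2 in the hypothesis. -/
lemma reproduces_commutatorWord {𝒜 : Type} [Ring 𝒜] [Algebra ℂ 𝒜] (A : ι → 𝒜) (H : 𝒜) (i j : ι)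
    (h : A i * A j - A j * A i = (2 : ℂ) • H) : Reproduces A 2 H 3 (commutatorWord i j) := by
  have hH : H = (1 / 2 : ℂ) • (A i * A j - A j * A i) := by
    rw [h, smul_smul]
    norm_num
  have hc : ((√(1 / 2) : ℝ) : ℂ) ^ 2 = 1 / 2 := by
    rw [← Complex.ofReal_pow, Real.sq_sqrt (by norm_num)]
    norm_num
  rw [commutatorWord]
  generalize √(1 / 2) = c at hc
  intro n hn
  interval_cases n
  · rw [coeff_zero_wordSeries, coeff_zero_formalExp]
  · simp [wordSeries, coeff_mul, coeff_formalExp, Finset.Nat.antidiagonal_succ]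
  · rw [hH]
    simp [wordSeries, coeff_mul, coeff_formalExp, Finset.Nat.antidiagonal_succ, pow_two,
      mul_add]
    match_scalars <;> first | linear_combination hc | linear_combination -hc | exact sub_self _ | (ring_nf; exact sub_self _)

/-- The symmetric second-order product formula. -/
noncomputable def strangWord (i j : ι) : List (ι × ℝ) := [(i, 1 / 2), (j, 1), (i, 1 / 2)]

lemma reproduces_strangWord {𝒜 : Type} [Ring 𝒜] [Algebra ℂ 𝒜] (A : ι → 𝒜) (i j : ι) :
    Reproduces A 1 (A i + A j) 3 (strangWord i j) := by
  -- Only degrees 0 and 1 need computing; degree 2 follows from the palindrome symmetry.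
  have h : Reproduces A 1 (A i + A j) 2 (strangWord i j) := by
    intro n hn
    interval_cases n
    · rw [coeff_zero_wordSeries, coeff_zero_formalExp]
    · simp [wordSeries, strangWord, coeff_mul, coeff_formalExp, Finset.Nat.antidiagonal_succ]
      module
  exact h.succ_of_reverse_eq even_two (by simp [strangWord])

/-- Words of `4 * 6 ^ (p - 1)` exponentials that reproduce an exponentiated commutator up to
terms of order `2 p + 1`. -/
lemma exists_commutator_word (p : ℕ) (hp : 1 ≤ p) (i j : ι) :
    ∃ W : List (ι × ℝ), W.length = 4 * 6 ^ (p - 1) ∧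
      ∀ {𝒜 : Type} [Ring 𝒜] [Algebra ℂ 𝒜] (A : ι → 𝒜) (H : 𝒜),
        A i * A j - A j * A i = (2 : ℂ) • H → Reproduces A 2 H (2 * p + 1) W := by
  induction p, hp using Nat.le_induction with
  | base => exact ⟨commutatorWord i j, rfl, fun A H h => reproduces_commutatorWord A H i j h⟩
  | succ p hp ih =>
    obtain ⟨W, hl, hW⟩ := ih
    obtain ⟨V, hVl, hV⟩ := exists_commutator_step p hp W
    refine ⟨V, ?_, fun A H h => hV A H (hW A H h)⟩
    obtain ⟨k, rfl⟩ := Nat.exists_eq_add_of_le' hp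
    rw [hVl, hl]
    simp only [Nat.add_sub_cancel]
    ring

/-- Suzuki's product formulas, of order `2 q`. -/
lemma exists_suzuki_word (q : ℕ) (hq : 1 ≤ q) (i j : ι) :
    ∃ W : List (ι × ℝ), W.length = 3 * 5 ^ (q - 1) ∧ W.reverse = W ∧
      ∀ {𝒜 : Type} [Ring 𝒜] [Algebra ℂ 𝒜] (A : ι → 𝒜),
        Reproduces A 1 (A i + A j) (2 * q + 1) W := by
  induction q, hq using Nat.le_induction with
  | base => exact ⟨strangWord i j, rfl, rfl, fun A => reproduces_strangWord A i j⟩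
  | succ q hq ih =>
    obtain ⟨W, hl, hrev, hW⟩ := ih
    obtain ⟨V, hVl, hVrev, hV⟩ := exists_suzuki_step q hq W hrev
    refine ⟨V, ?_, hVrev, fun A => hV A _ (hW A)⟩
    obtain ⟨k, rfl⟩ := Nat.exists_eq_add_of_le' hq
    rw [hVl, hl]
    simp only [Nat.add_sub_cancel]
    ring

end Recursion

/-! ### Norm estimates for formal series -/

section Majorant

open PowerSeries Finset.HasAntidiagonal

variable {𝒜 : Type} [NormedRing 𝒜]

/-- The coefficients of `F` sum to `f`, and are dominated by `u ^ n * b n` for a series `b`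
with sum `B`. -/
def SumsTo (F : PowerSeries 𝒜) (f : 𝒜) (u B : ℝ) : Prop :=
  HasSum (fun n => coeff n F) f ∧
    ∃ b : ℕ → ℝ, (∀ n, 0 ≤ b n) ∧ HasSum b B ∧ ∀ n, ‖coeff n F‖ ≤ u ^ n * b n

variable {u : ℝ}

lemma SumsTo.summable_norm {F : PowerSeries 𝒜} {f : 𝒜} {B : ℝ} (h : SumsTo F f u B)
    (hu0 : 0 ≤ u) (hu1 : u ≤ 1) : Summable fun n => ‖coeff n F‖ := by
  obtain ⟨-, b, hb0, hb, hF⟩ := h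
  refine Summable.of_nonneg_of_le (fun _ => norm_nonneg _) (fun n => (hF n).trans ?_) hb.summable
  exact mul_le_of_le_one_left (hb0 n) (pow_le_one₀ hu0 hu1)

lemma SumsTo.mul [CompleteSpace 𝒜] {F G : PowerSeries 𝒜} {f g : 𝒜} {B C : ℝ}
    (hF : SumsTo F f u B) (hG : SumsTo G g u C) (hu0 : 0 ≤ u) (hu1 : u ≤ 1) :
    SumsTo (F * G) (f * g) u (B * C) := by
  have hFn := hF.summable_norm hu0 hu1
  have hGn := hG.summable_norm hu0 hu1
  obtain ⟨hf, b, hb0, hb, hFb⟩ := hF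
  obtain ⟨hg, c, hc0, hc, hGc⟩ := hG
  refine ⟨?_, fun n => ∑ m ∈ antidiagonal n, b m.1 * c m.2,
    fun n => Finset.sum_nonneg fun m _ => mul_nonneg (hb0 _) (hc0 _), ?_, fun n => ?_⟩
  · have h := (summable_norm_sum_mul_antidiagonal_of_summable_norm hFn hGn).of_norm.hasSum
    rw [← tsum_mul_tsum_eq_tsum_sum_antidiagonal_of_summable_norm hFn hGn, hf.tsum_eq,
      hg.tsum_eq] at h
    simpa only [coeff_mul] using h
  · have h := (summable_norm_sum_mul_antidiagonal_of_summable_norm hb.summable.norm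
      hc.summable.norm).of_norm.hasSum
    rwa [← tsum_mul_tsum_eq_tsum_sum_antidiagonal_of_summable_norm hb.summable.norm
      hc.summable.norm, hb.tsum_eq, hc.tsum_eq] at h
  · rw [coeff_mul, Finset.mul_sum]
    refine (norm_sum_le _ _).trans (Finset.sum_le_sum fun m hm => ?_)
    calc ‖coeff m.1 F * coeff m.2 G‖ ≤ ‖coeff m.1 F‖ * ‖coeff m.2 G‖ := norm_mul_le _ _
      _ ≤ (u ^ m.1 * b m.1) * (u ^ m.2 * c m.2) :=
        mul_le_mul (hFb _) (hGc _) (norm_nonneg _) (mul_nonneg (pow_nonneg hu0 _) (hb0 _))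
      _ = u ^ n * (b m.1 * c m.2) := by
        rw [← mem_antidiagonal.mp hm, pow_add]
        ring

/-- The coefficients below degree `m` cancel, and in the remaining ones `u^n ≤ u^m` because `u ≤ 1`.
-/
lemma SumsTo.norm_sub_le {F G : PowerSeries 𝒜} {f g : 𝒜} {B C : ℝ}
    (hF : SumsTo F f u B) (hG : SumsTo G g u C) (hu0 : 0 ≤ u) (hu1 : u ≤ 1) {m : ℕ}
    (h : ∀ n < m, coeff n F = coeff n G) : ‖f - g‖ ≤ (B + C) * u ^ m := by
  obtain ⟨hf, b, hb0, hb, hFb⟩ := hF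
  obtain ⟨hg, c, hc0, hc, hGc⟩ := hG
  refine (hf.sub hg).norm_le_of_bounded ((hb.add hc).mul_right (u ^ m)) fun n => ?_
  rcases lt_or_ge n m with hn | hn
  · rw [h n hn, sub_self, norm_zero]
    exact mul_nonneg (add_nonneg (hb0 n) (hc0 n)) (pow_nonneg hu0 _)
  · calc ‖coeff n F - coeff n G‖ ≤ u ^ n * b n + u ^ n * c n :=
        (_root_.norm_sub_le _ _).trans (add_le_add (hFb n) (hGc n))
      _ = (b n + c n) * u ^ n := by ring
      _ ≤ (b n + c n) * u ^ m := mul_le_mul_of_nonneg_left (pow_le_pow_of_le_one hu0 hu1 hn)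
        (add_nonneg (hb0 n) (hc0 n))

variable [NormedAlgebra ℂ 𝒜]

/-- The majorant is the exponential series of `|s| κ`, placed in the degrees divisible by `r`. The
bound on `‖1‖` is assumed in place of `‖1‖ = 1`, which fails for matrices over an empty index type.
-/
lemma sumsTo_formalExp [CompleteSpace 𝒜] (h1 : ‖(1 : 𝒜)‖ ≤ 1) {r : ℕ} (hr : 0 < r) (s : ℝ) {H : 𝒜}
    {κ : ℝ} (hκ : 0 ≤ κ) (hH : ‖H‖ ≤ κ * u ^ r) :
    SumsTo (formalExp r s H) (NormedSpace.exp ((s : ℂ) • H)) u (Real.exp (|s| * κ)) := by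
  have hinj : Function.Injective fun k : ℕ => r * k :=
    fun a b hab => Nat.eq_of_mul_eq_mul_left hr hab
  have hnot {n : ℕ} (hn : n ∉ Set.range fun k : ℕ => r * k) : ¬ r ∣ n :=
    fun ⟨k, hk⟩ => hn ⟨k, hk.symm⟩
  have hpow (k : ℕ) : ‖H ^ k‖ ≤ (κ * u ^ r) ^ k := by
    rcases Nat.eq_zero_or_pos k with rfl | hk
    · simpa using h1
    · exact (norm_pow_le' H hk).trans (pow_le_pow_left₀ (norm_nonneg _) hH k)
  refine ⟨?_, fun n => if r ∣ n then (|s| * κ) ^ (n / r) / (n / r).factorial else 0, ?_, ?_, ?_⟩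
  · refine (hinj.hasSum_iff fun n hn => ?_).mp ?_
    · rw [coeff_formalExp, if_neg (hnot hn)]
    · convert NormedSpace.exp_series_hasSum_exp' (𝕂 := ℂ) ((s : ℂ) • H) using 2 with k
      simp only [Function.comp_apply, coeff_formalExp, dvd_mul_right, if_true,
        Nat.mul_div_cancel_left _ hr]
      rw [smul_pow, smul_smul]
      congr 1
      ring
  · intro n
    dsimp only
    split_ifs
    · positivity
    · exact le_rfl
  · refine (hinj.hasSum_iff fun n hn => ?_).mp ?_
    · rw [if_neg (hnot hn)]
    · rw [Real.exp_eq_exp_ℝ]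
      have h := NormedSpace.expSeries_div_hasSum_exp (|s| * κ)
      refine h.congr_fun fun k => ?_
      simp only [Function.comp_apply, dvd_mul_right, if_true, Nat.mul_div_cancel_left _ hr]
  · intro n
    rw [coeff_formalExp]
    dsimp only
    split_ifs with h
    · obtain ⟨k, rfl⟩ := h
      rw [Nat.mul_div_cancel_left _ hr, norm_smul, norm_div, norm_pow, Complex.norm_real,
        Complex.norm_natCast, Real.norm_eq_abs]
      calc |s| ^ k / k.factorial * ‖H ^ k‖ ≤ |s| ^ k / k.factorial * (κ * u ^ r) ^ k :=
            mul_le_mul_of_nonneg_left (hpow k) (by positivity)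
        _ = u ^ (r * k) * ((|s| * κ) ^ k / k.factorial) := by
            rw [pow_mul]
            ring
    · simp

lemma sumsTo_wordSeries [CompleteSpace 𝒜] (h1 : ‖(1 : 𝒜)‖ ≤ 1) {ι : Type} {A : ι → 𝒜} {κ : ℝ}
    (hκ : 0 ≤ κ) (hu0 : 0 ≤ u) (hu1 : u ≤ 1) (hA : ∀ i, ‖A i‖ ≤ κ * u) (W : List (ι × ℝ)) :
    SumsTo (wordSeries A W) (W.map fun g => NormedSpace.exp ((g.2 : ℂ) • A g.1)).prod u
      (W.map fun g => Real.exp (|g.2| * κ)).prod := by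
  induction W with
  | nil =>
    have h := sumsTo_formalExp (u := u) h1 one_pos 0 (H := (0 : 𝒜)) le_rfl (by simp)
    simpa [formalExp_zero, wordSeries] using h
  | cons g W ih =>
    have h := sumsTo_formalExp h1 one_pos g.2 (H := A g.1) hκ (by simpa using hA g.1)
    exact h.mul ih hu0 hu1

/-- A word that reproduces `exp(τ^r H)` to order `m` approximates it, with a constant that
depends only on the word. -/
lemma Reproduces.norm_sub_le [CompleteSpace 𝒜] (h1 : ‖(1 : 𝒜)‖ ≤ 1) {ι : Type} {A : ι → 𝒜} {κ : ℝ}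
    (hκ : 0 ≤ κ) (hu0 : 0 ≤ u) (hu1 : u ≤ 1) (hA : ∀ i, ‖A i‖ ≤ κ * u) {W : List (ι × ℝ)}
    {r m : ℕ} (hr : 0 < r) {H : 𝒜} (hH : ‖H‖ ≤ κ * u ^ r) (hW : Reproduces A r H m W) :
    ‖(W.map fun g => NormedSpace.exp ((g.2 : ℂ) • A g.1)).prod - NormedSpace.exp H‖
      ≤ ((W.map fun g => Real.exp (|g.2| * κ)).prod + Real.exp κ) * u ^ m := by
  have h := (sumsTo_wordSeries h1 hκ hu0 hu1 hA W).norm_sub_le (sumsTo_formalExp h1 hr 1 hκ hH)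
    hu0 hu1 hW
  simpa using h

end Majorant

/-! ### Operators on qubit ⊗ mode -/

section QubitTensor

open Matrix

variable {n : Type}

lemma qubitTensor_conjTranspose (S : Matrix (Fin 2) (Fin 2) ℂ) (A : Matrix n n ℂ) :
    (qubitTensor S A)ᴴ = qubitTensor Sᴴ Aᴴ := by
  simp [qubitTensor, fromBlocks_conjTranspose, conjTranspose_smul]

lemma qubitTensor_add (S : Matrix (Fin 2) (Fin 2) ℂ) (A B : Matrix n n ℂ) :
    qubitTensor S (A + B) = qubitTensor S A + qubitTensor S B := by
  simp [qubitTensor, fromBlocks_add]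

lemma qubitTensor_sub_left (S T : Matrix (Fin 2) (Fin 2) ℂ) (A : Matrix n n ℂ) :
    qubitTensor (S - T) A = qubitTensor S A - qubitTensor T A := by
  simp [qubitTensor, add_smul, sub_eq_add_neg, fromBlocks_neg, fromBlocks_add]

lemma qubitTensor_smul (c : ℂ) (S : Matrix (Fin 2) (Fin 2) ℂ) (A : Matrix n n ℂ) :
    qubitTensor S (c • A) = c • qubitTensor S A := by
  simp [qubitTensor, fromBlocks_smul, smul_comm c]

lemma qubitTensor_smul_left (c : ℂ) (S : Matrix (Fin 2) (Fin 2) ℂ) (A : Matrix n n ℂ) :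
    qubitTensor (c • S) A = c • qubitTensor S A := by
  simp [qubitTensor, fromBlocks_smul, mul_smul]

lemma pauli_conjTranspose (k : PauliAxis) : (pauli k)ᴴ = pauli k := by
  cases k <;> ext i j <;> fin_cases i <;> fin_cases j <;> simp [pauli]

lemma qubitTensor_pauli_conjTranspose (k : PauliAxis) {A : Matrix n n ℂ} (hA : A.IsHermitian) :
    (qubitTensor (pauli k) A)ᴴ = qubitTensor (pauli k) A := by
  rw [qubitTensor_conjTranspose, pauli_conjTranspose, hA.eq]

end QubitTensor

section Blocks

open Matrix

variable {m n : Type} [Fintype m] [Fintype n] [DecidableEq n]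

/-- Such a `P` is an orthogonal projection; the C*-identity gives `‖P‖² = ‖P‖`. -/
lemma l2_opNorm_le_one_of_conjTranspose_mul_self {P : Matrix n n ℂ} (h : Pᴴ * P = P) : ‖P‖ ≤ 1 := by
  have h1 := l2_opNorm_conjTranspose_mul_self P
  rw [h] at h1
  nlinarith [norm_nonneg P]

lemma l2_opNorm_one_le : ‖(1 : Matrix n n ℂ)‖ ≤ 1 :=
  l2_opNorm_le_one_of_conjTranspose_mul_self (by simp)

lemma l2_opNorm_le_one_of_isometry {V : Matrix m n ℂ} (h : Vᴴ * V = 1) : ‖V‖ ≤ 1 := by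
  have h1 := l2_opNorm_conjTranspose_mul_self V
  rw [h] at h1
  have h2 := l2_opNorm_one_le (n := n)
  nlinarith [norm_nonneg V]

lemma l2_opNorm_fromRows_one_zero : ‖(fromRows 1 0 : Matrix (n ⊕ n) n ℂ)‖ ≤ 1 :=
  l2_opNorm_le_one_of_isometry (by simp [conjTranspose_fromRows_eq_fromCols_conjTranspose,
    fromCols_mul_fromRows])

lemma l2_opNorm_fromRows_zero_one : ‖(fromRows 0 1 : Matrix (n ⊕ n) n ℂ)‖ ≤ 1 :=
  l2_opNorm_le_one_of_isometry (by simp [conjTranspose_fromRows_eq_fromCols_conjTranspose,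
    fromCols_mul_fromRows])

lemma l2_opNorm_mul_mul_conjTranspose_le [DecidableEq m] {V W : Matrix m n ℂ} (hV : ‖V‖ ≤ 1) (hW : ‖W‖ ≤ 1)
    (A : Matrix n n ℂ) : ‖V * A * Wᴴ‖ ≤ ‖A‖ :=
  calc ‖V * A * Wᴴ‖ ≤ ‖V‖ * ‖A‖ * ‖W‖ := by
        refine (l2_opNorm_mul _ _).trans ?_
        rw [l2_opNorm_conjTranspose]
        exact mul_le_mul_of_nonneg_right (l2_opNorm_mul _ _) (norm_nonneg _)
    _ ≤ 1 * ‖A‖ * 1 := by gcongr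
    _ = ‖A‖ := by ring

lemma l2_opNorm_fromBlocks_le (A B C D : Matrix n n ℂ) :
    ‖fromBlocks A B C D‖ ≤ ‖A‖ + ‖B‖ + ‖C‖ + ‖D‖ := by
  have h1 := l2_opNorm_fromRows_one_zero (n := n)
  have h2 := l2_opNorm_fromRows_zero_one (n := n)
  set V : Matrix (n ⊕ n) n ℂ := fromRows 1 0 with hV
  set W : Matrix (n ⊕ n) n ℂ := fromRows 0 1 with hW
  -- `V` and `W` are the isometric embeddings of the mode space as the two qubit levels.
  have h : fromBlocks A B C D = V * A * Vᴴ + V * B * Wᴴ + W * C * Vᴴ + W * D * Wᴴ := by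
    simp [hV, hW, conjTranspose_fromRows_eq_fromCols_conjTranspose, fromRows_mul]
    ext (i | i) (j | j) <;> simp
  rw [h]
  refine norm_add₄_le.trans ?_
  gcongr <;> exact l2_opNorm_mul_mul_conjTranspose_le ‹_› ‹_› _

lemma qubitTensor_mul (S T : Matrix (Fin 2) (Fin 2) ℂ) (A B : Matrix n n ℂ) :
    qubitTensor S A * qubitTensor T B = qubitTensor (S * T) (A * B) := by
  simp only [qubitTensor, fromBlocks_multiply, Matrix.mul_apply, Fin.sum_univ_two, smul_mul_smul_comm,
    add_smul]

lemma norm_qubitTensor_pauli_le (k : PauliAxis) (A : Matrix n n ℂ) :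
    ‖qubitTensor (pauli k) A‖ ≤ 2 * ‖A‖ := by
  refine (l2_opNorm_fromBlocks_le _ _ _ _).trans ?_
  simp only [norm_smul]
  cases k <;> simp [pauli] <;> linarith

/-- The axes are ordered against the usual orientation: the sign in `-2i` offsets `(iτ)² = -τ²` from
the two displacement generators. -/
lemma exists_pauli_commutator (k : PauliAxis) : ∃ i j : PauliAxis,
    pauli i * pauli j - pauli j * pauli i = (-2 * Complex.I) • pauli k := by
  cases k
  · refine ⟨.z, .y, ?_⟩
    ext a b
    fin_cases a <;> fin_cases b <;> simp [pauli] <;> ring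
  · refine ⟨.x, .z, ?_⟩
    ext a b
    fin_cases a <;> fin_cases b <;> simp [pauli] <;> ring_nf <;> simp
  · refine ⟨.y, .x, ?_⟩
    ext a b
    fin_cases a <;> fin_cases b <;> simp [pauli] <;> ring

lemma exp_smul_conjTranspose_mul_self {B : Matrix n n ℂ} (hB : Bᴴ = B) (t : ℝ) :
    (NormedSpace.exp ((Complex.I * (t : ℂ)) • B))ᴴ * NormedSpace.exp ((Complex.I * (t : ℂ)) • B)
      = 1 := by
  rw [← Matrix.exp_conjTranspose, conjTranspose_smul, hB]
  have : star (Complex.I * (t : ℂ)) = -(Complex.I * t) := by simp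
  have hc : Commute (-((Complex.I * (t : ℂ)) • B)) ((Complex.I * (t : ℂ)) • B) :=
    (Commute.refl _).neg_left
  rw [this, neg_smul, ← Matrix.exp_add_of_commute _ _ hc,
    neg_add_cancel, NormedSpace.exp_zero]

lemma norm_hybridExp_le_one (k : PauliAxis) {A : Matrix n n ℂ} (hA : A.IsHermitian) (t : ℝ) :
    ‖hybridExp k A t‖ ≤ 1 :=
  l2_opNorm_le_one_of_isometry
    (exp_smul_conjTranspose_mul_self (qubitTensor_pauli_conjTranspose k hA) t)

lemma hybridExp_conjTranspose (k : PauliAxis) {A : Matrix n n ℂ} (hA : A.IsHermitian) (t : ℝ) :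
    (hybridExp k A t)ᴴ = hybridExp k A (-t) := by
  rw [hybridExp, ← Matrix.exp_conjTranspose, conjTranspose_smul,
    qubitTensor_pauli_conjTranspose k hA, hybridExp]
  simp

lemma norm_displacementProd_le_one (W : List (PauliAxis × ℝ)) {Q : Matrix n n ℂ}
    (hQ : Q.IsHermitian) (τ : ℝ) : ‖displacementProd W Q τ‖ ≤ 1 := by
  induction W with
  | nil => simpa [displacementProd] using l2_opNorm_one_le (n := n ⊕ n)
  | cons g W ih =>
    change ‖hybridExp g.1 Q (g.2 * τ) * displacementProd W Q τ‖ ≤ 1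
    exact (norm_mul_le _ _).trans (mul_le_one₀ (norm_hybridExp_le_one _ hQ _) (norm_nonneg _) ih)

lemma displacementProd_undo (W : List (PauliAxis × ℝ)) {Q : Matrix n n ℂ}
    (hQ : Q.IsHermitian) (τ : ℝ) :
    displacementProd (undo W) Q τ = (displacementProd W Q τ)ᴴ := by
  induction W with
  | nil => simp [displacementProd, undo]
  | cons g W ih =>
    have h1 : displacementProd (undo (g :: W)) Q τ
        = displacementProd (undo W) Q τ * hybridExp g.1 Q (-g.2 * τ) := by
      simp [displacementProd, undo]
    have h2 : displacementProd (g :: W) Q τ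
        = hybridExp g.1 Q (g.2 * τ) * displacementProd W Q τ := by
      simp [displacementProd]
    rw [h1, h2, conjTranspose_mul, ih, hybridExp_conjTranspose _ hQ, neg_mul]

lemma norm_synthExp_le_one (W : List (PauliAxis × ℝ)) {Q : Matrix n n ℂ}
    (hQ : Q.IsHermitian) (s : ℝ) : ‖synthExp W Q s‖ ≤ 1 := by
  rw [synthExp]
  split_ifs <;> exact norm_displacementProd_le_one _ hQ _

/-- At negative times both operators are the adjoints of those at `|s|`, so it suffices to treat
nonnegative times. -/
lemma norm_synthExp_sub_eq (k : PauliAxis) (W : List (PauliAxis × ℝ)) {Q : Matrix n n ℂ}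
    (hQ : Q.IsHermitian) (s : ℝ) : ‖synthExp W Q s - hybridExp k (Q ^ 2) s‖
      = ‖displacementProd W Q √|s| - hybridExp k (Q ^ 2) |s|‖ := by
  rw [synthExp]
  split_ifs with h
  · rw [abs_of_nonneg h]
  · rw [displacementProd_undo W hQ, abs_of_neg (not_le.mp h), ← l2_opNorm_conjTranspose,
      conjTranspose_sub, conjTranspose_conjTranspose, hybridExp_conjTranspose _ (hQ.pow 2)]

end Blocks

/-! ### Synthesized exponentials and product formulas -/

section Synthesis

open Matrix

/-- Removes the restriction `u ≤ 1` of the series estimate: for `u > 1` the bound `x ≤ 2` already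
gives `x ≤ 2 u^e`. -/
lemma le_mul_rpow_of_le_two {x u K e : ℝ} {m : ℕ} (hu : 0 ≤ u) (hK : 0 ≤ K) (hx : x ≤ 2)
    (h : u ≤ 1 → x ≤ K * u ^ m) (he0 : 0 ≤ e) (he : e ≤ m) : x ≤ (K + 2) * u ^ e := by
  have hp : 0 ≤ u ^ e := Real.rpow_nonneg hu _
  rcases le_or_gt u 1 with h1 | h1
  · have h2 : u ^ m ≤ u ^ e := by
      rcases hu.eq_or_lt with rfl | hu'
      · rcases he0.eq_or_lt with rfl | he'
        · simpa using pow_le_one₀ le_rfl h1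
        · rw [Real.zero_rpow he'.ne', zero_pow]
          rintro rfl
          simp only [Nat.cast_zero] at he
          linarith
      · rw [← Real.rpow_natCast]
        exact Real.rpow_le_rpow_of_exponent_ge hu' h1 he
    nlinarith [h h1, mul_le_mul_of_nonneg_left h2 hK]
  · have h2 : 1 ≤ u ^ e := Real.one_le_rpow h1.le he0
    nlinarith

lemma exists_synthExp (p : ℕ) (hp : 1 ≤ p) (k : PauliAxis) :
    ∃ K : ℝ, 0 < K ∧ ∃ W : List (PauliAxis × ℝ), W.length ≤ 8 * 6 ^ (p - 1) ∧
      ∀ (d : ℕ) (Q : Matrix (Fin d) (Fin d) ℂ), Q.IsHermitian → ∀ s : ℝ,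
        ‖synthExp W Q s - hybridExp k (Q ^ 2) s‖
          ≤ K * (‖Q‖ ^ 2 * |s|) ^ ((p : ℝ) + 1 / 2) := by
  obtain ⟨i, j, hij⟩ := exists_pauli_commutator k
  obtain ⟨W, hl, hW⟩ := exists_commutator_word p hp i j
  set B : ℝ := (W.map fun g => Real.exp (|g.2| * 2)).prod + Real.exp 2 with hB
  have hB0 : 0 ≤ B := by
    refine add_nonneg (List.prod_nonneg fun x hx => ?_) (Real.exp_pos _).le
    obtain ⟨g, -, rfl⟩ := List.mem_map.mp hx
    exact (Real.exp_pos _).le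
  refine ⟨B + 2, by linarith, W, by rw [hl]; gcongr; norm_num, fun d Q hQ s => ?_⟩
  rw [norm_synthExp_sub_eq k W hQ]
  set τ : ℝ := √|s| with hτ
  have hτ0 : 0 ≤ τ := Real.sqrt_nonneg _
  have hs : |s| = τ ^ 2 := (Real.sq_sqrt (abs_nonneg s)).symm
  have hu0 : 0 ≤ ‖Q‖ * τ := mul_nonneg (norm_nonneg _) hτ0
  -- The small parameter is `u = ‖Q‖ √|s|`, so the order `2p+1` in `u` is the order `p + 1/2` in
  -- `‖Q‖² |s|`.
  have hrpow : (‖Q‖ ^ 2 * |s|) ^ ((p : ℝ) + 1 / 2) = (‖Q‖ * τ) ^ ((2 * p + 1 : ℕ) : ℝ) := by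
    rw [hs, ← mul_pow, ← Real.rpow_natCast (‖Q‖ * τ) 2, ← Real.rpow_mul hu0]
    congr 1
    push_cast
    ring
  rw [hrpow]
  refine le_mul_rpow_of_le_two hu0 hB0 ?_ (fun hu1 => ?_) (Nat.cast_nonneg _) le_rfl
  · have h1 := norm_displacementProd_le_one W hQ τ
    have h2 := norm_hybridExp_le_one k (hQ.pow 2) |s|
    linarith [norm_sub_le (displacementProd W Q τ) (hybridExp k (Q ^ 2) |s|)]
  · set A : PauliAxis → Matrix (Fin d ⊕ Fin d) (Fin d ⊕ Fin d) ℂ :=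
      fun l => (Complex.I * (τ : ℂ)) • qubitTensor (pauli l) Q with hA
    set H : Matrix (Fin d ⊕ Fin d) (Fin d ⊕ Fin d) ℂ :=
      (Complex.I * ((|s| : ℝ) : ℂ)) • qubitTensor (pauli k) (Q ^ 2) with hH
    have hcomm : A i * A j - A j * A i = (2 : ℂ) • H := by
      simp only [hA, hH, smul_mul_smul_comm, qubitTensor_mul]
      rw [← smul_sub, ← qubitTensor_sub_left, hij, qubitTensor_smul_left, smul_smul, smul_smul,
        ← pow_two Q, hs]
      congr 1
      push_cast
      linear_combination (-2 * Complex.I * τ ^ 2) * Complex.I_mul_I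
    have hAn (l : PauliAxis) : ‖A l‖ ≤ 2 * (‖Q‖ * τ) := by
      simp only [hA, norm_smul, norm_mul, Complex.norm_I, one_mul, Complex.norm_real,
        Real.norm_eq_abs, abs_of_nonneg hτ0]
      nlinarith [mul_le_mul_of_nonneg_left (norm_qubitTensor_pauli_le l Q) hτ0]
    have hHn : ‖H‖ ≤ 2 * (‖Q‖ * τ) ^ 2 := by
      simp only [hH, norm_smul, norm_mul, Complex.norm_I, one_mul, Complex.norm_real,
        Real.norm_eq_abs, abs_abs]
      rw [hs, mul_pow, pow_two Q]
      nlinarith [mul_le_mul_of_nonneg_left (norm_qubitTensor_pauli_le k (Q * Q)) (sq_nonneg τ),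
        mul_le_mul_of_nonneg_left (norm_mul_le Q Q) (sq_nonneg τ)]
    have h := (hW A H hcomm).norm_sub_le l2_opNorm_one_le zero_le_two hu0 hu1 hAn two_pos hHn
    have hprod : displacementProd W Q τ
        = (W.map fun g => NormedSpace.exp ((g.2 : ℂ) • A g.1)).prod := by
      rw [displacementProd]
      congr 2
      ext1 g
      rw [hybridExp, hA, smul_smul]
      congr 2
      push_cast
      ring
    rw [hprod]
    exact h

/-- The product formula `T` run with exact exponentials. -/
noncomputable def exactFormula {n : Type} [Fintype n] [DecidableEq n] (k : PauliAxis)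
    (T : List (Quadrature × ℝ)) (X P : Matrix n n ℂ) (t : ℝ) : Matrix (n ⊕ n) (n ⊕ n) ℂ :=
  (T.map fun g => hybridExp k ((g.1.op X P) ^ 2) (g.2 * t)).prod

lemma isHermitian_op {n : Type} {X P : Matrix n n ℂ} (hX : X.IsHermitian) (hP : P.IsHermitian)
    (q : Quadrature) : (q.op X P).IsHermitian := by
  cases q
  · exact hX
  · exact hP

section

variable {n : Type} [Fintype n] [DecidableEq n] {X P : Matrix n n ℂ}

lemma scaleConst_nonneg : 0 ≤ scaleConst X P := (norm_nonneg _).trans (le_max_left _ _)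

lemma norm_op_sq_le_scaleConst (q : Quadrature) : ‖q.op X P‖ ^ 2 ≤ scaleConst X P := by
  cases q
  · exact (le_max_left _ _).trans (le_max_right _ _)
  · exact (le_max_right _ _).trans (le_max_right _ _)

lemma norm_exactFormula_le_one (k : PauliAxis) (T : List (Quadrature × ℝ)) (hX : X.IsHermitian)
    (hP : P.IsHermitian) (t : ℝ) : ‖exactFormula k T X P t‖ ≤ 1 := by
  induction T with
  | nil => simpa [exactFormula] using l2_opNorm_one_le (n := n ⊕ n)
  | cons g T ih =>
    change ‖hybridExp k ((g.1.op X P) ^ 2) (g.2 * t) * exactFormula k T X P t‖ ≤ 1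
    exact (norm_mul_le _ _).trans (mul_le_one₀
      (norm_hybridExp_le_one _ ((isHermitian_op hX hP _).pow 2) _) (norm_nonneg _) ih)

/-- Replace the factors one at a time. The others are contractions, so the individual errors add,
and the factor with coefficient `c` contributes `K |c|^e (C t)^e`. -/
lemma norm_productFormula_sub_exactFormula_le {k : PauliAxis} {W : List (PauliAxis × ℝ)}
    (T : List (Quadrature × ℝ)) (hX : X.IsHermitian) (hP : P.IsHermitian) {K e t : ℝ}
    (hK : 0 ≤ K) (he : 0 ≤ e) (ht : 0 ≤ t)
    (hW : ∀ (q : Quadrature) (s : ℝ), ‖synthExp W (q.op X P) s - hybridExp k ((q.op X P) ^ 2) s‖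
      ≤ K * (‖q.op X P‖ ^ 2 * |s|) ^ e) :
    ‖productFormula T W X P t - exactFormula k T X P t‖
      ≤ K * (T.map fun g => |g.2| ^ e).sum * (scaleConst X P * t) ^ e := by
  induction T with
  | nil => simp [productFormula, exactFormula]
  | cons g T ih =>
    set U := synthExp W (g.1.op X P) (g.2 * t) with hU
    set V := hybridExp k ((g.1.op X P) ^ 2) (g.2 * t) with hV
    have h1 : productFormula (g :: T) W X P t - exactFormula k (g :: T) X P t
        = U * (productFormula T W X P t - exactFormula k T X P t)
          + (U - V) * exactFormula k T X P t := by
      simp only [productFormula, exactFormula, List.map_cons, List.prod_cons, ← hU, ← hV]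
      noncomm_ring
    have hUV : ‖U - V‖ ≤ K * |g.2| ^ e * (scaleConst X P * t) ^ e := by
      refine (hW g.1 (g.2 * t)).trans ?_
      have hC := norm_op_sq_le_scaleConst (X := X) (P := P) g.1
      have hC0 := scaleConst_nonneg (X := X) (P := P)
      rw [mul_assoc, ← Real.mul_rpow (abs_nonneg _) (mul_nonneg hC0 ht), abs_mul, abs_of_nonneg ht]
      refine mul_le_mul_of_nonneg_left (Real.rpow_le_rpow (by positivity) ?_ he) hK
      calc ‖g.1.op X P‖ ^ 2 * (|g.2| * t) ≤ scaleConst X P * (|g.2| * t) := by gcongr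
        _ = |g.2| * (scaleConst X P * t) := by ring
    rw [h1, List.map_cons, List.sum_cons]
    calc _ ≤ ‖U‖ * ‖productFormula T W X P t - exactFormula k T X P t‖
          + ‖U - V‖ * ‖exactFormula k T X P t‖ :=
        (norm_add_le _ _).trans (add_le_add (norm_mul_le _ _) (norm_mul_le _ _))
      _ ≤ 1 * ‖productFormula T W X P t - exactFormula k T X P t‖ + ‖U - V‖ * 1 := by
        gcongr
        · exact norm_synthExp_le_one _ (isHermitian_op hX hP _) _
        · exact norm_exactFormula_le_one _ _ hX hP _
      _ ≤ _ := by linarith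

end

lemma exists_exactFormula (p : ℕ) (hp : 1 ≤ p) :
    ∃ K : ℝ, 0 < K ∧ ∃ T : List (Quadrature × ℝ),
      (T.length : ℝ) ≤ 4 * (5 : ℝ) ^ ((p : ℝ) / 2 - 1 / 4) ∧
      ∀ (k : PauliAxis) (d : ℕ) (X P : Matrix (Fin d) (Fin d) ℂ), X.IsHermitian → P.IsHermitian →
        ∀ t : ℝ, 0 ≤ t → ‖exactFormula k T X P t - hybridExp k (X ^ 2 + P ^ 2) t‖
          ≤ K * (scaleConst X P * t) ^ ((p : ℝ) + 1 / 2) := by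
  -- This `q` is the least integer with `2q ≥ p`, so the error order `2q+1` exceeds `p + 1/2`.
  -- Moreover `q - 1 ≤ p/2 - 1/2`, which keeps `3 · 5^(q-1)` within the claimed length.
  obtain ⟨q, hq⟩ : ∃ q, q = (p + 1) / 2 := ⟨_, rfl⟩
  have hq1 : 1 ≤ q := by omega
  obtain ⟨T, hl, -, hT⟩ := exists_suzuki_word q hq1 Quadrature.position Quadrature.momentum
  set B : ℝ := (T.map fun g => Real.exp (|g.2| * 2)).prod + Real.exp 2 with hB
  have hB0 : 0 ≤ B := by
    refine add_nonneg (List.prod_nonneg fun x hx => ?_) (Real.exp_pos _).le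
    obtain ⟨g, -, rfl⟩ := List.mem_map.mp hx
    exact (Real.exp_pos _).le
  refine ⟨B + 2, by linarith, T, ?_, fun k d X P hX hP t ht => ?_⟩
  · rw [hl]
    push_cast
    rw [← Real.rpow_natCast]
    refine mul_le_mul (by norm_num) (Real.rpow_le_rpow_of_exponent_le (by norm_num) ?_)
      (by positivity) (by norm_num)
    have h : 2 * q ≤ p + 1 := by omega
    have h' : 2 * (q : ℝ) ≤ p + 1 := by exact_mod_cast h
    rw [Nat.cast_sub hq1]
    push_cast
    linarith
  have hC0 := scaleConst_nonneg (X := X) (P := P)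
  have hu0 : 0 ≤ scaleConst X P * t := mul_nonneg hC0 ht
  have hHerm : (X ^ 2 + P ^ 2).IsHermitian := (hX.pow 2).add (hP.pow 2)
  have hpq : (p : ℝ) ≤ 2 * q := by
    have h : p ≤ 2 * q := by omega
    exact_mod_cast h
  refine le_mul_rpow_of_le_two (m := 2 * q + 1) hu0 hB0 ?_ (fun hu1 => ?_) (by positivity)
    (by push_cast; linarith)
  · have h1 := norm_exactFormula_le_one k T hX hP t
    have h2 := norm_hybridExp_le_one k hHerm t
    linarith [norm_sub_le (exactFormula k T X P t) (hybridExp k (X ^ 2 + P ^ 2) t)]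
  · set A : Quadrature → Matrix (Fin d ⊕ Fin d) (Fin d ⊕ Fin d) ℂ :=
      fun g => (Complex.I * (t : ℂ)) • qubitTensor (pauli k) ((g.op X P) ^ 2) with hA
    have hsum : A .position + A .momentum
        = (Complex.I * (t : ℂ)) • qubitTensor (pauli k) (X ^ 2 + P ^ 2) := by
      rw [qubitTensor_add, smul_add]
      rfl
    have hbound (M : Matrix (Fin d) (Fin d) ℂ) (hM : ‖M‖ ≤ scaleConst X P) :
        ‖(Complex.I * (t : ℂ)) • qubitTensor (pauli k) M‖ ≤ 2 * (scaleConst X P * t) := by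
      simp only [norm_smul, norm_mul, Complex.norm_I, one_mul, Complex.norm_real,
        Real.norm_eq_abs, abs_of_nonneg ht]
      nlinarith [mul_le_mul_of_nonneg_left (norm_qubitTensor_pauli_le k M) ht]
    have hAn (g : Quadrature) : ‖A g‖ ≤ 2 * (scaleConst X P * t) := by
      refine hbound _ (le_trans ?_ (norm_op_sq_le_scaleConst g))
      rw [pow_two, pow_two]
      exact norm_mul_le _ _
    have hHn : ‖A .position + A .momentum‖ ≤ 2 * (scaleConst X P * t) ^ 1 := by
      rw [hsum, pow_one]
      -- Here the term `‖X² + P²‖` in the definition of `C` is used: the target generator obeys the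
      -- same bound as the two summands.
      exact hbound _ (le_max_left _ _)
    have h := (hT A).norm_sub_le l2_opNorm_one_le zero_le_two hu0 hu1 hAn one_pos hHn
    have hprod : exactFormula k T X P t
        = (T.map fun g => NormedSpace.exp ((g.2 : ℂ) • A g.1)).prod := by
      rw [exactFormula]
      congr 2
      ext1 g
      rw [hybridExp, hA, smul_smul]
      congr 2
      push_cast
      ring
    rw [hsum, ← hprod] at h
    exact h

end Synthesis

/-! ### The truncated mode -/

section Fock

open Matrix

lemma blockEncoding_eq_hybridExp {n : Type} [Fintype n] [DecidableEq n] {A : Matrix n n ℂ}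
    (hA : A.IsHermitian) (t : ℝ) : blockEncoding A t = hybridExp .x A t := by
  rw [blockEncoding, hybridExp, hA.eq]
  simp [qubitTensor, pauli]

lemma isHermitian_positionOp (L : ℕ) : (positionOp L).IsHermitian := by
  rw [Matrix.IsHermitian, positionOp, conjTranspose_smul, conjTranspose_add,
    conjTranspose_conjTranspose, add_comm (annihilation L)ᴴ]
  simp

lemma isHermitian_momentumOp (L : ℕ) : (momentumOp L).IsHermitian := by
  rw [Matrix.IsHermitian, momentumOp, conjTranspose_smul, conjTranspose_sub,
    conjTranspose_conjTranspose, ← neg_sub, smul_neg, ← neg_smul]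
  congr 1
  simp
  ring

lemma positionOp_sq_add_momentumOp_sq (L : ℕ) : positionOp L ^ 2 + momentumOp L ^ 2
    = (1 / 2 : ℂ) • (annihilation L * (annihilation L)ᴴ + numberOp L) := by
  rw [positionOp, momentumOp, numberOp, smul_pow, smul_pow]
  have h : (-(Complex.I / 2)) ^ 2 = -(1 / 4 : ℂ) := by
    rw [neg_sq, div_pow, Complex.I_sq]
    norm_num
  rw [h]
  simp only [pow_two, mul_add, add_mul, mul_sub, sub_mul]
  module

lemma numberOp_eq_diagonal (L : ℕ) :
    numberOp L = diagonal fun n : Fin (L + 1) => ((n : ℕ) : ℂ) := by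
  ext m n
  rw [numberOp, Matrix.mul_apply, diagonal_apply]
  simp only [conjTranspose_apply, annihilation, of_apply]
  split_ifs with h
  · subst h
    rcases Nat.eq_zero_or_pos (m : ℕ) with h0 | h0
    · rw [h0]
      simp
    · have hlt : (m : ℕ) - 1 < L + 1 := by omega
      rw [Finset.sum_eq_single (⟨(m : ℕ) - 1, hlt⟩ : Fin (L + 1))]
      · have h1 : (m : ℕ) - 1 + 1 = m := by omega
        simp only [h1, if_true]
        rw [Complex.star_def, Complex.conj_ofReal, ← Complex.ofReal_mul,
          Real.mul_self_sqrt (Nat.cast_nonneg _), Complex.ofReal_natCast]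
      · intro j _ hj
        rw [if_neg, mul_zero]
        intro h1
        exact hj (Fin.ext (by simp only; omega))
      · simp
  · refine Finset.sum_eq_zero fun j _ => ?_
    by_cases h1 : (j : ℕ) + 1 = n
    · rw [if_neg, star_zero, zero_mul]
      intro h2
      exact h (Fin.ext (by omega))
    · rw [if_neg h1, mul_zero]

/-- Truncation shows only at the top level: `a†` annihilates `|L⟩`, so the diagonal entry there is 0
instead of `L + 1`. -/
lemma annihilation_mul_conjTranspose (L : ℕ) : annihilation L * (annihilation L)ᴴ
    = diagonal fun n : Fin (L + 1) => if (n : ℕ) < L then ((n : ℕ) : ℂ) + 1 else 0 := by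
  ext m n
  rw [Matrix.mul_apply, diagonal_apply]
  simp only [conjTranspose_apply, annihilation, of_apply]
  by_cases h : m = n ∧ (m : ℕ) < L
  · obtain ⟨rfl, hm⟩ := h
    rw [if_pos rfl, if_pos hm, Finset.sum_eq_single (⟨(m : ℕ) + 1, by omega⟩ : Fin (L + 1))]
    · simp only [if_true]
      rw [Complex.star_def, Complex.conj_ofReal, ← Complex.ofReal_mul,
        Real.mul_self_sqrt (Nat.cast_nonneg _), Complex.ofReal_natCast, Nat.cast_succ]
    · intro j _ hj
      rw [if_neg, zero_mul]
      intro h1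
      exact hj (Fin.ext h1.symm)
    · simp
  · have h0 : (if m = n then if (m : ℕ) < L then ((m : ℕ) : ℂ) + 1 else 0 else 0) = 0 := by
      split_ifs with h1 h2
      · exact absurd ⟨h1, h2⟩ h
      · rfl
      · rfl
    rw [h0]
    refine Finset.sum_eq_zero fun j _ => ?_
    by_cases h1 : (m : ℕ) + 1 = j
    · rw [if_neg (c := (n : ℕ) + 1 = j), star_zero, mul_zero]
      intro h2
      exact h ⟨Fin.ext (by omega), by omega⟩
    · rw [if_neg h1, zero_mul]

/-- Below the cutoff, `(a a† + a† a)/2` has eigenvalue `((n+1) + n)/2 = n + 1/2`. At `n = L` the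
identity fails, hence the projector. -/
lemma positionOp_sq_add_momentumOp_sq_mul_belowCutoff (L : ℕ) :
    (positionOp L ^ 2 + momentumOp L ^ 2 - (1 / 2 : ℂ) • 1) * belowCutoff L
      = numberOp L * belowCutoff L := by
  rw [positionOp_sq_add_momentumOp_sq, annihilation_mul_conjTranspose, numberOp_eq_diagonal,
    belowCutoff, diagonal_add, ← diagonal_one, ← diagonal_smul, ← diagonal_smul, diagonal_sub,
    diagonal_mul_diagonal, diagonal_mul_diagonal]
  congr 1
  ext n
  split_ifs with h
  · simp only [Pi.smul_apply, smul_eq_mul, if_pos h]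
    ring
  · simp

lemma belowCutoff_mul_numberOp (L : ℕ) :
    belowCutoff L * numberOp L = numberOp L * belowCutoff L := by
  rw [numberOp_eq_diagonal, belowCutoff, diagonal_mul_diagonal, diagonal_mul_diagonal]
  simp only [mul_comm]

lemma norm_qubitTensor_one_belowCutoff_le (L : ℕ) : ‖qubitTensor 1 (belowCutoff L)‖ ≤ 1 := by
  refine l2_opNorm_le_one_of_conjTranspose_mul_self ?_
  rw [qubitTensor_conjTranspose, qubitTensor_mul, conjTranspose_one, mul_one, belowCutoff,
    diagonal_conjTranspose, diagonal_mul_diagonal]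
  congr 2
  ext n
  by_cases h : (n : ℕ) < L <;> simp [h]

/-- By induction `a^n c = b^n c`: the rightmost `a` becomes `b`, which then moves past `c` to let
the induction continue. -/
lemma exp_mul_eq_of_mul_eq {m : Type} [Fintype m] [DecidableEq m] {a b c : Matrix m m ℂ}
    (h1 : a * c = b * c) (h2 : c * b = b * c) :
    NormedSpace.exp a * c = NormedSpace.exp b * c := by
  have hpow (n : ℕ) : a ^ n * c = b ^ n * c := by
    induction n with
    | zero => simp
    | succ n ih => rw [pow_succ, mul_assoc, h1, ← h2, ← mul_assoc, ih, mul_assoc, h2, ← mul_assoc,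
        ← pow_succ]
  have ha := (NormedSpace.exp_series_hasSum_exp' (𝕂 := ℂ) a).mul_right c
  have hb := (NormedSpace.exp_series_hasSum_exp' (𝕂 := ℂ) b).mul_right c
  refine ha.unique ?_
  simpa only [smul_mul_assoc, hpow] using hb

lemma hybridExp_mul_hybridExp_mul_belowCutoff (k : PauliAxis) (L : ℕ) (t : ℝ) :
    hybridExp k 1 (-t / 2) * hybridExp k (positionOp L ^ 2 + momentumOp L ^ 2) t
        * qubitTensor 1 (belowCutoff L)
      = hybridExp k (numberOp L) t * qubitTensor 1 (belowCutoff L) := by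
  have h := positionOp_sq_add_momentumOp_sq_mul_belowCutoff L
  generalize positionOp L ^ 2 + momentumOp L ^ 2 = M at h ⊢
  have hcomm : Commute ((Complex.I * ((-t / 2 : ℝ) : ℂ)) • qubitTensor (pauli k)
      (1 : Matrix (Fin (L + 1)) (Fin (L + 1)) ℂ))
      ((Complex.I * (t : ℂ)) • qubitTensor (pauli k) M) := by
    refine Commute.smul_left (Commute.smul_right ?_ _) _
    rw [Commute, SemiconjBy, qubitTensor_mul, qubitTensor_mul, one_mul, mul_one]
  have hsum : (Complex.I * ((-t / 2 : ℝ) : ℂ)) • qubitTensor (pauli k) 1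
      + (Complex.I * (t : ℂ)) • qubitTensor (pauli k) M
      = (Complex.I * (t : ℂ)) • qubitTensor (pauli k) (M - (1 / 2 : ℂ) • 1) := by
    rw [sub_eq_add_neg, ← neg_smul, qubitTensor_add, qubitTensor_smul]
    push_cast
    module
  rw [hybridExp, hybridExp, ← Matrix.exp_add_of_commute _ _ hcomm, hsum, hybridExp]
  refine exp_mul_eq_of_mul_eq ?_ ?_
  · rw [smul_mul_assoc, smul_mul_assoc, qubitTensor_mul, qubitTensor_mul, h]
  · rw [smul_mul_assoc, mul_smul_comm, qubitTensor_mul, qubitTensor_mul, one_mul, mul_one,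
      belowCutoff_mul_numberOp]

end Fock

/-! ### Assembly of the two approximations -/

lemma exists_synthExp_exactFormula (p : ℕ) (hp : 1 ≤ p) :
    ∃ K : ℝ, 0 < K ∧ ∀ k : PauliAxis,
      ∃ (W : List (PauliAxis × ℝ)) (T : List (Quadrature × ℝ)),
        W.length ≤ 8 * 6 ^ (p - 1) ∧
        (T.length : ℝ) ≤ 4 * (5 : ℝ) ^ ((p : ℝ) / 2 - 1 / 4) ∧
        (∀ (d : ℕ) (Q : Matrix (Fin d) (Fin d) ℂ), Q.IsHermitian → ∀ s : ℝ,
          ‖synthExp W Q s - hybridExp k (Q ^ 2) s‖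
            ≤ K * (‖Q‖ ^ 2 * |s|) ^ ((p : ℝ) + 1 / 2)) ∧
        (∀ (d : ℕ) (X P : Matrix (Fin d) (Fin d) ℂ), X.IsHermitian → P.IsHermitian →
          ∀ t : ℝ, 0 ≤ t →
            ‖productFormula T W X P t - hybridExp k (X ^ 2 + P ^ 2) t‖
              ≤ K * (scaleConst X P * t) ^ ((p : ℝ) + 1 / 2)) := by
  choose κ hκ W hWl hW using exists_synthExp p hp
  obtain ⟨K', hK', T, hTl, hT⟩ := exists_exactFormula p hp
  set e : ℝ := (p : ℝ) + 1 / 2 with he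
  have he0 : 0 ≤ e := by positivity
  -- The sum over the three axes makes the constant independent of `k`.
  set κ' : ℝ := κ .x + κ .y + κ .z with hκ'
  have hle (k : PauliAxis) : κ k ≤ κ' := by
    have h1 := hκ .x
    have h2 := hκ .y
    have h3 := hκ .z
    cases k <;> linarith
  have hκ0 : 0 < κ' := (hκ .x).trans_le (hle .x)
  have hS : 0 ≤ (T.map fun g => |g.2| ^ e).sum := by
    refine List.sum_nonneg fun x hx => ?_
    obtain ⟨g, -, rfl⟩ := List.mem_map.mp hx
    positivity
  refine ⟨κ' + κ' * (T.map fun g => |g.2| ^ e).sum + K', by positivity,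
    fun k => ⟨W k, T, hWl k, hTl, fun d Q hQ s => ?_, fun d X P hX hP t ht => ?_⟩⟩
  · refine (hW k d Q hQ s).trans (mul_le_mul_of_nonneg_right ?_ (by positivity))
    linarith [hle k, mul_nonneg hκ0.le hS]
  · have h1 := norm_productFormula_sub_exactFormula_le T hX hP (W := W k) hκ0.le he0 ht
      fun q s => (hW k d _ (isHermitian_op hX hP q) s).trans
        (mul_le_mul_of_nonneg_right (hle k) (by positivity))
    have h2 := hT k d X P hX hP t ht
    have hu : 0 ≤ (scaleConst X P * t) ^ e :=
      Real.rpow_nonneg (mul_nonneg scaleConst_nonneg ht) _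
    have h3 := norm_sub_le_norm_sub_add_norm_sub (productFormula T (W k) X P t)
      (exactFormula k T X P t) (hybridExp k (X ^ 2 + P ^ 2) t)
    linarith [mul_nonneg hκ0.le hu]

end QubitMode

theorem mainTheorem10 (p : ℕ) (hp : 1 ≤ p) :
    ∃ K : ℝ, 0 < K ∧ ∀ k : PauliAxis,
      ∃ (W : List (PauliAxis × ℝ)) (T : List (Quadrature × ℝ)),
        -- number of conditional displacements in one synthesized exponential
        W.length ≤ 8 * 6 ^ (p - 1) ∧
        -- number of synthesized exponentials
        (T.length : ℝ) ≤ 4 * (5 : ℝ) ^ ((p : ℝ) / 2 - 1 / 4) ∧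
        -- a synthesized exponential approximates `exp(i s Q² σ^k)`
        (∀ (d : ℕ) (Q : Matrix (Fin d) (Fin d) ℂ), Q.IsHermitian → ∀ s : ℝ,
          ‖synthExp W Q s - hybridExp k (Q ^ 2) s‖
            ≤ K * (‖Q‖ ^ 2 * |s|) ^ ((p : ℝ) + 1 / 2)) ∧
        -- arbitrary Hermitian (truncated) position and momentum operators
        (∀ (d : ℕ) (X P : Matrix (Fin d) (Fin d) ℂ), X.IsHermitian → P.IsHermitian →
          ∀ t : ℝ, 0 ≤ t →
            ‖productFormula T W X P t - hybridExp k (X ^ 2 + P ^ 2) t‖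
              ≤ K * (scaleConst X P * t) ^ ((p : ℝ) + 1 / 2)) ∧
        -- the block encoding of `x̂² + p̂²`, for the Fock cutoff `L`
        (k = PauliAxis.x → ∀ (L : ℕ) (t : ℝ), 0 ≤ t →
          ‖productFormula T W (positionOp L) (momentumOp L) t
              - blockEncoding (positionOp L ^ 2 + momentumOp L ^ 2) t‖
            ≤ K * (scaleConst (positionOp L) (momentumOp L) * t) ^ ((p : ℝ) + 1 / 2)) ∧
        -- the conditional rotation, on states supported strictly below the cutoff
        (∀ (L : ℕ) (t : ℝ), 0 ≤ t →
          ‖(hybridExp k 1 (-t / 2) * productFormula T W (positionOp L) (momentumOp L) t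
              - hybridExp k (numberOp L) t) * qubitTensor 1 (belowCutoff L)‖
            ≤ K * (scaleConst (positionOp L) (momentumOp L) * t) ^ ((p : ℝ) + 1 / 2)) := by
  obtain ⟨K, hK, h⟩ := exists_synthExp_exactFormula p hp
  refine ⟨K, hK, fun k => ?_⟩
  obtain ⟨W, T, hWl, hTl, hW, hT⟩ := h k
  refine ⟨W, T, hWl, hTl, hW, hT, ?_, fun L t ht => ?_⟩
  · rintro rfl L t ht
    rw [blockEncoding_eq_hybridExp
      (((isHermitian_positionOp L).pow 2).add ((isHermitian_momentumOp L).pow 2))]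
    exact hT (L + 1) _ _ (isHermitian_positionOp L) (isHermitian_momentumOp L) t ht
  · have h1 := hT (L + 1) _ _ (isHermitian_positionOp L) (isHermitian_momentumOp L) t ht
    -- On the range of the projector the target is the rotated exact exponential, so the error is
    -- the previous one between two contractions.
    rw [sub_mul, ← hybridExp_mul_hybridExp_mul_belowCutoff, ← sub_mul, ← mul_sub]
    refine le_trans ?_ h1
    have h2 := norm_hybridExp_le_one k
      (Matrix.isHermitian_one (n := Fin (L + 1)) (α := ℂ)) (-t / 2)
    have h3 := norm_qubitTensor_one_belowCutoff_le L
    refine (norm_mul_le _ _).trans ((mul_le_of_le_one_right (norm_nonneg _) h3).trans ?_)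
    exact (norm_mul_le _ _).trans (mul_le_of_le_one_left (norm_nonneg _) h2)
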